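/- Let $R$ be a commutative ring and let $q\in R$ be invertible (for example, $q$ an indeterminate and $R=\mathbb Z[q,q^{-1}]$). An infinite continued fraction whose entries are formal power series over $R$ is understood as the formal power series to which its finite truncations converge coefficientwise, that is, each coefficient of the truncations is eventually constant. (1) The continued fraction $$F(1)=\cfrac{1}{1+v-\cfrac{(1-q)^2v}{1+v-\cfrac{(1-q^2)^2v}{1+v-\cdots}}}$$ converges in $R[[v]]$, and for every integer $N\ge 0$ $$[v^N]F(1)=q^{N(N+1)}\sum_{-N\le n\le N}(-1)^n q^{-n^2}.$$ (2) The continued fraction $$\cfrac{1}{1-\cfrac{(1-q)^2z}{1-\cfrac{(1-q^2)^2z}{1-\cdots}}}$$ converges in $R[[z]]$, and for every integer $N\ge 0$ its coefficient of $z^N$ is $$\sum_{k=0}^{N}\left[\binom{2N}{N-k}-\binom{2N}{N-k-1}\right]q^{k(k+1)}\sum_{-k\le j\le k}(-1)^j q^{-j^2},$$ where $\binom{2N}{-1}=0$. -/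

import Mathlib

namespace FormalCF

/-- The `m`-th convergent (the first `m` levels) of the continued fraction
`1 / (b - a 0 / (b - a 1 / (b - a 2 / ...)))` with entries in the ring of formal power series.
All denominators that occur have constant coefficient `1` as soon as `b` has constant coefficient
`1` and the `a i` have constant coefficient `0`; `PowerSeries.invOfUnit _ 1` is then the inverse
(see `convergent_spec`). -/
noncomputable def convergent {R : Type*} [CommRing R] (b : PowerSeries R) :
    (ℕ → PowerSeries R) → ℕ → PowerSeries R
  | _, 0 => 0
  | a, m + 1 => PowerSeries.invOfUnit (b - a 0 * convergent b (fun i => a (i + 1)) m) 1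

theorem convergent_spec {R : Type*} [CommRing R] (b : PowerSeries R) (a : ℕ → PowerSeries R)
    (hb : PowerSeries.constantCoeff b = 1) (ha : PowerSeries.constantCoeff (a 0) = 0) (m : ℕ) :
    (b - a 0 * convergent b (fun i => a (i + 1)) m) * convergent b a (m + 1) = 1 := by
  rw [convergent]
  exact PowerSeries.mul_invOfUnit _ _ (by simp [hb, ha])

/-- The infinite continued fraction `1 / (b - a 0 / (b - a 1 / ...))` converges to the formal power
series `F`: every coefficient of the convergents is eventually equal to that of `F`. -/
def HasValue {R : Type*} [CommRing R] (b : PowerSeries R) (a : ℕ → PowerSeries R)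
    (F : PowerSeries R) : Prop :=
  ∀ N : ℕ, ∀ᶠ m in Filter.atTop,
    PowerSeries.coeff N (convergent b a m) = PowerSeries.coeff N F

theorem HasValue.unique {R : Type*} [CommRing R] {b : PowerSeries R} {a : ℕ → PowerSeries R}
    {F G : PowerSeries R} (hF : HasValue b a F) (hG : HasValue b a G) : F = G := by
  ext N
  obtain ⟨m, h1, h2⟩ := ((hF N).and (hG N)).exists
  exact h1.symm.trans h2

/-- The partial numerators `(1 - q ^ (i + 1) * t) ^ 2 * X`, for `i = 0, 1, 2, ...`. -/
noncomputable def numerators {R : Type*} [CommRing R] (q t : R) (i : ℕ) : PowerSeries R :=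
  PowerSeries.C ((1 - q ^ (i + 1) * t) ^ 2) * PowerSeries.X

/-- The binomial coefficient with an integer lower index, zero when that index is negative. -/
def binom (n : ℕ) (k : ℤ) : ℤ := if 0 ≤ k then (n.choose k.toNat : ℤ) else 0

end FormalCF

/-! If `F_i` is the `i`-th tail, the products `u_i = F_0 ⋯ F_(i-1)` satisfy `u_0 = 1` and `u_i = b
u_(i+1) - a_i u_(i+2)`. Conversely, any power series solution of this recurrence with `u_0 = 1`
forces the value `u_1` (`coeff_convergent_eq`), so it suffices to exhibit solutions. For `b = 1 +
v`, over a field where no positive power of `q` is `1`, a solution is an explicit `q`-hypergeometric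
sum, checked by telescoping (`tailCoeff_rec`). Its case `m = 1` obeys the same second-order
recurrence in `N` as the truncated theta sum. For the second fraction, put `z = v / (1 + v) ^ 2`:
then `(1 + v) ^ i * u_i` solves the recurrence with `b = 1`, and Lagrange inversion produces the
ballot numbers. General `R` follows by specializing from `ℤ[T;T⁻¹]`, which embeds in such a field.
-/

namespace FormalCF

open PowerSeries

/-! ### Convergents and the three-term recurrence -/

section General

variable {R : Type*} [CommRing R]

/-- If `u i = b * u (i + 1) - X * c i * u (i + 2)`, then the convergents of the `i`-th tail
approximate `u (i + 1) / u i`. -/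
theorem X_pow_dvd_convergent_mul_sub (b : PowerSeries R) (hb : constantCoeff b = 1) (m : ℕ) :
    ∀ (a u : ℕ → PowerSeries R), (∀ i, X ∣ a i) →
      (∀ i, u i = b * u (i + 1) - a i * u (i + 2)) →
      X ^ m ∣ convergent b a m * u 0 - u 1 := by
  induction m with
  | zero => intro a u _ _; simp
  | succ m ih =>
    intro a u ha hu
    have h := ih (fun i => a (i + 1)) (fun i => u (i + 1)) (fun i => ha _) (fun i => hu _)
    have hs := convergent_spec b a hb (X_dvd_iff.mp (ha 0)) m
    set c := convergent b (fun i => a (i + 1)) m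
    set d := convergent b a (m + 1)
    -- One more level multiplies the error by `a 0`, hence gains a factor `X`.
    have key : d * u 0 - u 1 = a 0 * (c * u 1 - u 2) * d := by
      rw [hu 0]
      linear_combination u 1 * hs
    rw [key, pow_succ']
    exact Dvd.dvd.mul_right (mul_dvd_mul (ha 0) h) d

theorem coeff_convergent_eq {b : PowerSeries R} (hb : constantCoeff b = 1)
    {a u : ℕ → PowerSeries R} (ha : ∀ i, X ∣ a i) (hu0 : u 0 = 1)
    (hu : ∀ i, u i = b * u (i + 1) - a i * u (i + 2)) {N m : ℕ} (h : N < m) :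
    coeff N (convergent b a m) = coeff N (u 1) := by
  have := X_pow_dvd_iff.mp (X_pow_dvd_convergent_mul_sub b hb m a u ha hu) N h
  rwa [hu0, mul_one, map_sub, sub_eq_zero] at this

theorem X_dvd_numerators (q t : R) (i : ℕ) : X ∣ numerators q t i :=
  Dvd.intro_left _ rfl

theorem map_numerators {S : Type*} [CommRing S] (φ : R →+* S) (q t : R) (i : ℕ) :
    PowerSeries.map φ (numerators q t i) = numerators (φ q) (φ t) i := by
  simp [numerators]

theorem map_convergent {S : Type*} [CommRing S] (φ : R →+* S) (b : PowerSeries R)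
    (hb : constantCoeff b = 1) (m : ℕ) : ∀ (a : ℕ → PowerSeries R), (∀ i, X ∣ a i) →
      PowerSeries.map φ (convergent b a m) =
        convergent (PowerSeries.map φ b) (fun i => PowerSeries.map φ (a i)) m := by
  induction m with
  | zero => intro a _; simp [convergent]
  | succ m ih =>
    intro a ha
    have h1 := congrArg (PowerSeries.map φ) (convergent_spec b a hb (X_dvd_iff.mp (ha 0)) m)
    have h2 := convergent_spec (PowerSeries.map φ b) (fun i => PowerSeries.map φ (a i))
      (by rw [← coeff_zero_eq_constantCoeff_apply, coeff_map, coeff_zero_eq_constantCoeff_apply,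
            hb, map_one])
      (X_dvd_iff.mp (by simpa using map_dvd (PowerSeries.map φ) (ha 0))) m
    rw [map_mul, map_sub, map_mul, ih _ (fun i => ha _), map_one] at h1
    rw [mul_comm] at h1
    exact left_inv_eq_right_inv h1 h2

/-! ### Ballot numbers and the substitution `z = v / (1 + v) ^ 2` -/

/-- The difference of consecutive binomial coefficients. -/
def ballot (n : ℕ) (k : ℤ) : ℤ := binom n k - binom n (k - 1)

theorem binom_succ (n : ℕ) (k : ℤ) : binom (n + 1) k = binom n k + binom n (k - 1) := by
  rcases lt_trichotomy k 0 with h | rfl | h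
  · simp [binom, not_le.mpr h, show ¬ (1 ≤ k) by omega]
  · simp [binom]
  · obtain ⟨j, rfl⟩ : ∃ j : ℕ, k = j + 1 := ⟨(k - 1).toNat, by omega⟩
    have h1 : ((j : ℤ) + 1).toNat = j + 1 := by omega
    simp [binom, h1, Nat.choose_succ_succ, show (0 : ℤ) ≤ j + 1 by omega]
    ring

theorem ballot_succ (n : ℕ) (k : ℤ) : ballot (n + 1) k = ballot n k + ballot n (k - 1) := by
  simp only [ballot, binom_succ]
  ring

theorem ballot_of_neg (n : ℕ) {k : ℤ} (hk : k < 0) : ballot n k = 0 := by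
  simp [ballot, binom, not_le.mpr hk, show ¬ (1 ≤ k) by omega]

theorem ballot_zero (n : ℕ) : ballot n 0 = 1 := by
  simp [ballot, binom]

theorem ballot_middle (n : ℕ) : ballot (2 * n + 1) (n + 1) = 0 := by
  have h1 : ((n : ℤ) + 1).toNat = n + 1 := by omega
  have := Nat.choose_symm_half n
  simp [ballot, binom, h1, show (0 : ℤ) ≤ n + 1 by omega, this]

/-- The passage from the tails of the fraction in `v` to those of the fraction in
`z = v / (1 + v) ^ 2`. -/
def ballotTransform (u : ℕ → ℕ → R) : ℕ → ℕ → R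
  | 0, N => u 0 N
  | m + 1, N => ∑ k ∈ Finset.range (N + 1), (ballot (m + 2 * N) (N - k) : R) * u (m + 1) k

/-- By Lagrange inversion, `[z^N] H = [v^N] (1 - v) (1 + v) ^ (2N - 1) H`; the transform is the case
`H = (1 + v) ^ m * u_m`. Pascal's rule plays the role of multiplication by `1 + v`. -/
theorem ballotTransform_rec {u : ℕ → ℕ → R} {c : ℕ → R}
    (h0 : ∀ N, u 0 (N + 1) = 0)
    (hz : ∀ m, u (m + 1) 0 = u m 0)
    (hu : ∀ m N, u m (N + 1) = u (m + 1) (N + 1) + u (m + 1) N - c m * u (m + 2) N) (m N : ℕ) :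
    ballotTransform u m (N + 1) =
      ballotTransform u (m + 1) (N + 1) - c m * ballotTransform u (m + 2) N := by
  -- This form also covers `m = 0`: only `k = 0` could contribute, and its ballot number is the
  -- vanishing middle one.
  have hm : ballotTransform u m (N + 1) =
      ∑ k ∈ Finset.range (N + 2), (ballot (m + 2 * N + 1) ((N + 1 : ℕ) - k) : R) * u m k := by
    cases m with
    | zero =>
      rw [Finset.sum_range_succ']
      have h2 := ballot_middle N
      simp [ballotTransform, h0, h2]
    | succ m =>
      simp only [ballotTransform]
      refine Finset.sum_congr rfl fun k _ => ?_
      rw [show m + 1 + 2 * N + 1 = m + 2 * (N + 1) by ring]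
  rw [hm]
  simp only [ballotTransform]
  rw [show m + 2 * (N + 1) = m + 2 * N + 1 + 1 by ring,
    show m + 1 + 2 * N = m + 2 * N + 1 by ring]
  simp only [ballot_succ (m + 2 * N + 1), Int.cast_add, add_mul, Finset.sum_add_distrib]
  rw [Finset.sum_range_succ' _ (N + 1), Finset.sum_range_succ' _ (N + 1),
    Finset.sum_range_succ _ (N + 1), ballot_of_neg _ (k := ((N + 1 : ℕ) : ℤ) - (N + 1 : ℕ) - 1) (by omega)]
  simp only [hu m, hz m, mul_sub, mul_add, Finset.sum_sub_distrib, Finset.sum_add_distrib,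
    Finset.mul_sum]
  have e : ∀ k : ℕ, ((N + 1 : ℕ) : ℤ) - (k + 1 : ℕ) = N - k := fun k => by push_cast; ring
  have e' : ∀ k : ℕ, ((N + 1 : ℕ) : ℤ) - k - 1 = N - k := fun k => by push_cast; ring
  simp only [e, e', Int.cast_zero, zero_mul, add_zero, mul_left_comm (c m)]
  ring

end General

end FormalCF

namespace FormalCF
open PowerSeries
-- The explicit `q`-hypergeometric solution
section Field

variable {K : Type*} [Field K] (q : K)

/-- The `q`-factorial `(1 - q) ⋯ (1 - q ^ n)`. -/
def qFact (n : ℕ) : K := ∏ l ∈ Finset.range n, (1 - q ^ (l + 1))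

/-- The function `q ^ (j * (j + 1) / 2) / qFact q j` at `n = j + 2`, extended by zero. -/
def shiftedExp : ℕ → K
  | 0 => 0
  | 1 => 0
  | j + 2 => ∏ l ∈ Finset.range j, (q ^ (l + 1) / (1 - q ^ (l + 1)))

/-- The summands of the coefficients of `F_0 ⋯ F_m`, where `F_i` is the `i`-th tail of the
continued fraction. -/
def tailTerm (m N i : ℕ) : K :=
  (-1) ^ N * q ^ i * shiftedExp q (N + 2 - i) * qFact q (m + N + i) *
    (qFact (q ^ 2) i)⁻¹ * (qFact q m)⁻¹

/-- The coefficients of `F_0 ⋯ F_(m - 1)`, where `F_i` is the `i`-th tail of the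
continued fraction. -/
def tailCoeff : ℕ → ℕ → K
  | 0, N => if N = 0 then 1 else 0
  | m + 1, N => ∑ i ∈ Finset.range (N + 1), tailTerm q m N i

theorem qFact_succ (n : ℕ) : qFact q (n + 1) = qFact q n * (1 - q ^ (n + 1)) :=
  Finset.prod_range_succ _ _

variable {q}

theorem qFact_ne_zero (hq : ∀ n : ℕ, q ^ (n + 1) ≠ 1) (n : ℕ) : qFact q n ≠ 0 :=
  Finset.prod_ne_zero_iff.mpr fun l _ => sub_ne_zero.mpr (hq l).symm

theorem qFact_inv (hq : ∀ n : ℕ, q ^ (n + 1) ≠ 1) (n : ℕ) :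
    (qFact q n)⁻¹ = (1 - q ^ (n + 1)) * (qFact q (n + 1))⁻¹ := by
  have h1 := qFact_ne_zero hq n
  have h2 : 1 - q ^ (n + 1) ≠ 0 := sub_ne_zero.mpr (hq n).symm
  rw [qFact_succ]
  field_simp

theorem sq_pow_ne_one (hq : ∀ n : ℕ, q ^ (n + 1) ≠ 1) (n : ℕ) : (q ^ 2) ^ (n + 1) ≠ 1 := by
  rw [← pow_mul, show 2 * (n + 1) = 2 * n + 1 + 1 by ring]
  exact hq _

/-- The padding zeros keep this true at `j = 0`, so boundary terms need no special treatment. -/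
theorem shiftedExp_rec (hq : ∀ n : ℕ, q ^ (n + 1) ≠ 1) (j : ℕ) :
    (1 - q ^ j) * shiftedExp q (j + 2) = q ^ j * shiftedExp q (j + 1) := by
  cases j with
  | zero => simp [shiftedExp]
  | succ j =>
    have h2 : 1 - q ^ (j + 1) ≠ 0 := sub_ne_zero.mpr (hq j).symm
    simp only [shiftedExp, Finset.prod_range_succ]
    field_simp

theorem tailTerm_of_lt {m N i : ℕ} (h : N < i) : tailTerm q m N i = 0 := by
  have : N + 2 - i = 0 ∨ N + 2 - i = 1 := by omega
  rcases this with h | h <;> simp [tailTerm, h, shiftedExp]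

theorem tailCoeff_succ_eq_sum {m N M : ℕ} (h : N ≤ M) :
    tailCoeff q (m + 1) N = ∑ i ∈ Finset.range (M + 1), tailTerm q m N i := by
  refine Finset.sum_subset (fun i hi => ?_) (fun i _ hi => tailTerm_of_lt ?_) <;>
    simp at hi ⊢ <;> omega

theorem tailCoeff_zero_right (hq : ∀ n : ℕ, q ^ (n + 1) ≠ 1) (m : ℕ) : tailCoeff q m 0 = 1 := by
  cases m with
  | zero => simp [tailCoeff]
  | succ m =>
    have := qFact_ne_zero hq m
    have h0 : qFact (q ^ 2) 0 = 1 := by simp [qFact]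
    simp [tailCoeff, tailTerm, shiftedExp, this, h0]

/-- Pulling out `1 - q ^ m` makes one formula serve `m = 0` too, where both sides vanish. -/
theorem tailCoeff_succ_right (hq : ∀ n : ℕ, q ^ (n + 1) ≠ 1) (m N : ℕ) :
    tailCoeff q m (N + 1) = ∑ i ∈ Finset.range (N + 2), (1 - q ^ m) *
      ((-1) ^ (N + 1) * q ^ i * shiftedExp q (N + 3 - i) * qFact q (m + N + i) *
        (qFact (q ^ 2) i)⁻¹ * (qFact q m)⁻¹) := by
  cases m with
  | zero => simp [tailCoeff]
  | succ m =>
    simp only [tailCoeff, tailTerm]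
    refine Finset.sum_congr rfl fun i _ => ?_
    rw [qFact_inv hq m, show m + (N + 1) + i = m + 1 + N + i by ring]
    ring

theorem tailCoeff_rec (hq : ∀ n : ℕ, q ^ (n + 1) ≠ 1) (m N : ℕ) :
    tailCoeff q m (N + 1) = tailCoeff q (m + 1) (N + 1) + tailCoeff q (m + 1) N -
      (1 - q ^ (m + 1)) ^ 2 * tailCoeff q (m + 2) N := by
  -- Telescoping certificate: `G 0 = 0` through `1 - (q ^ 2) ^ 0`, and `G (N + 2) = 0` through
  -- `shiftedExp q 1`.
  let G : ℕ → K := fun i => q ^ m * (1 - (q ^ 2) ^ i) * (-1) ^ N * q ^ i *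
    shiftedExp q (N + 3 - i) * qFact q (m + N + i) * (qFact (q ^ 2) i)⁻¹ * (qFact q m)⁻¹
  have hG : ∑ i ∈ Finset.range (N + 2), (G i - G (i + 1)) = 0 := by
    rw [Finset.sum_range_sub']
    have : N + 3 - (N + 2) = 1 := by omega
    simp [G, this, shiftedExp]
  rw [tailCoeff_succ_right hq, tailCoeff_succ_eq_sum (le_refl (N + 1)),
    tailCoeff_succ_eq_sum (N.le_succ), tailCoeff_succ_eq_sum (N.le_succ), Finset.mul_sum,
    ← Finset.sum_add_distrib, ← Finset.sum_sub_distrib, ← sub_eq_zero, ← Finset.sum_sub_distrib,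
    ← hG]
  refine Finset.sum_congr rfl fun i hi => ?_
  obtain ⟨j, hj⟩ : ∃ j, N + 1 = i + j := ⟨N + 1 - i, by simp at hi; omega⟩
  have e1 : N + 3 - i = j + 2 := by omega
  have e2 : N + 2 - i = j + 1 := by omega
  have e3 : N + 3 - (i + 1) = j + 1 := by omega
  simp only [G, tailTerm, e1, e2, e3]
  rw [show m + (N + 1) + i = m + N + i + 1 by ring, show m + 1 + N + i = m + N + i + 1 by ring,
    show m + N + (i + 1) = m + N + i + 1 by ring, qFact_succ q (m + N + i),
    show m + N + i + 1 = m + i + j + i by omega, qFact_inv hq m,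
    qFact_inv (sq_pow_ne_one hq) i]
  have h := shiftedExp_rec hq j
  generalize shiftedExp q (j + 2) = x at *
  generalize shiftedExp q (j + 1) = y at *
  generalize qFact q (m + N + i) = p
  generalize (qFact q (m + 1))⁻¹ = r
  generalize (qFact (q ^ 2) (i + 1))⁻¹ = s
  linear_combination ((-1) ^ N * q ^ (m + 3 * i) * p * r * s * (1 - q ^ (m + 1)) *
    (1 - (q ^ 2) ^ (i + 1))) * h

/-- The factor `1 - (q ^ 2) ^ i` kills `i = 0` and cancels a factor of `qFact (q ^ 2) i`, so after
`i ↦ i + 1` the last part sums to `-q * tailCoeff q 1 (N + 1)`. -/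
theorem tailTerm_zero_rec (hq : ∀ n : ℕ, q ^ (n + 1) ≠ 1) (N i : ℕ) (hi : i ≤ N + 2) :
    tailTerm q 0 (N + 2) i = q ^ (2 * N + 3) * tailTerm q 0 N i +
      (1 - q ^ (2 * N + 3)) * ((-1) ^ N * q ^ i * shiftedExp q (N + 4 - i) * qFact q (N + i) *
        ((1 - (q ^ 2) ^ i) * (qFact (q ^ 2) i)⁻¹)) := by
  obtain ⟨j, hj⟩ : ∃ j, N + 2 = i + j := ⟨N + 2 - i, by omega⟩
  have e1 : N + 2 - i = j := by omega
  have e2 : N + 4 - i = j + 2 := by omega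
  simp only [tailTerm, e1, e2, zero_add]
  rw [show N + 2 + i = N + i + 1 + 1 by ring, qFact_succ, qFact_succ]
  generalize (qFact (q ^ 2) i)⁻¹ = s
  generalize qFact q (N + i) = p
  have hz : (qFact q 0)⁻¹ = 1 := by simp [qFact]
  rw [hz]
  cases j with
  | zero =>
    obtain rfl : i = N + 2 := by omega
    simp only [shiftedExp]
    ring
  | succ j =>
    have h1 := shiftedExp_rec hq (j + 1)
    have h2 := shiftedExp_rec hq j
    rw [show N + i + 1 + 1 = 2 * i + j + 1 by omega, show N + i + 1 = 2 * i + j by omega,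
      show 2 * N + 3 = 2 * i + 2 * j + 1 by omega, pow_succ (-1 : K) (N + 1), pow_succ (-1 : K) N]
    rw [show j + 1 + 1 = j + 2 by ring] at h1
    generalize shiftedExp q (j + 1 + 2) = x at *
    generalize shiftedExp q (j + 2) = y at *
    generalize shiftedExp q (j + 1) = z at *
    linear_combination ((-1) ^ N * q ^ (3 * i) * p * s * (1 - q ^ j)) * h1 +
      ((-1) ^ N * q ^ (3 * i + j + 1) * p * s) * h2

theorem tailCoeff_one_rec (hq : ∀ n : ℕ, q ^ (n + 1) ≠ 1) (N : ℕ) :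
    tailCoeff q 1 (N + 2) = q ^ (2 * N + 3) * tailCoeff q 1 N -
      q * (1 - q ^ (2 * N + 3)) * tailCoeff q 1 (N + 1) := by
  have key : ∑ i ∈ Finset.range (N + 3), ((-1) ^ N * q ^ i * shiftedExp q (N + 4 - i) *
      qFact q (N + i) * ((1 - (q ^ 2) ^ i) * (qFact (q ^ 2) i)⁻¹)) =
      -q * tailCoeff q 1 (N + 1) := by
    rw [Finset.sum_range_succ', tailCoeff, Finset.mul_sum]
    simp only [pow_zero, sub_self, zero_mul, mul_zero, add_zero]
    refine Finset.sum_congr rfl fun i _ => ?_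
    rw [← qFact_inv (sq_pow_ne_one hq) i, tailTerm, show N + 4 - (i + 1) = N + 1 + 2 - i by omega,
      show 0 + (N + 1) + i = N + (i + 1) by ring]
    simp only [qFact, Finset.range_zero, Finset.prod_empty]
    ring
  rw [tailCoeff, Finset.sum_congr rfl fun i hi => tailTerm_zero_rec hq N i (by simp at hi; omega),
    Finset.sum_add_distrib, ← Finset.mul_sum, ← Finset.mul_sum, key,
    ← tailCoeff_succ_eq_sum (by omega)]
  ring

theorem tailCoeff_one_one (hq : ∀ n : ℕ, q ^ (n + 1) ≠ 1) : tailCoeff q 1 1 = q ^ 2 - 2 * q := by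
  have h1 := sub_ne_zero.mpr (hq 0).symm
  have h2 := sub_ne_zero.mpr (hq 1).symm
  simp [tailCoeff, tailTerm, shiftedExp, Finset.sum_range_succ, qFact, Finset.prod_range_succ]
    at h1 h2 ⊢
  field_simp
  ring

end Field
end FormalCF

namespace FormalCF
open PowerSeries

/-! ### The truncated theta sum -/

section ThetaSum

variable {R : Type*} [CommRing R]

/-- The truncated theta sum `q ^ (N * (N + 1)) * ∑ (-1) ^ n * q ^ (-n ^ 2)` over `-N ≤ n ≤ N`. -/
noncomputable def thetaSum (q : Rˣ) (N : ℕ) : R :=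
  (q : R) ^ (N * (N + 1)) *
    ∑ n ∈ Finset.Icc (-(N : ℤ)) (N : ℤ), (((-1 : Rˣ) ^ n * q ^ (-(n ^ 2)) : Rˣ) : R)

theorem thetaSum_zero (q : Rˣ) : thetaSum q 0 = 1 := by
  simp [thetaSum]

theorem thetaSum_succ (q : Rˣ) (N : ℕ) : thetaSum q (N + 1) =
    (q : R) ^ (2 * N + 2) * thetaSum q N + 2 * (-1) ^ (N + 1) * (q : R) ^ (N + 1) := by
  have h : Finset.Icc (-((N + 1 : ℕ) : ℤ)) ((N + 1 : ℕ) : ℤ) =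
      insert (-((N : ℤ) + 1)) (insert ((N : ℤ) + 1) (Finset.Icc (-(N : ℤ)) (N : ℤ))) := by
    ext x
    simp only [Finset.mem_Icc, Finset.mem_insert]
    omega
  have hs : ((-1 : Rˣ) ^ (-((N : ℤ) + 1))) = (-1) ^ (N + 1) := by
    rw [zpow_neg, ← inv_zpow, inv_neg, inv_one]
    exact_mod_cast zpow_natCast (-1 : Rˣ) (N + 1)
  have hs' : ((-1 : Rˣ) ^ ((N : ℤ) + 1)) = (-1) ^ (N + 1) := by
    exact_mod_cast zpow_natCast (-1 : Rˣ) (N + 1)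
  have hq : (q : R) ^ ((N + 1) * (N + 1 + 1)) * ((q ^ (-((N : ℤ) + 1) ^ 2) : Rˣ) : R) =
      (q : R) ^ (N + 1) := by
    rw [← Units.val_pow_eq_pow_val, ← Units.val_pow_eq_pow_val, ← Units.val_mul,
      ← zpow_natCast, ← zpow_natCast, ← zpow_add]
    congr 2
    push_cast
    ring
  rw [thetaSum, h, Finset.sum_insert (by simp; omega), Finset.sum_insert (by simp), hs, hs',
    neg_sq, thetaSum]
  simp only [Units.val_mul, Units.val_pow_eq_pow_val, Units.val_neg, Units.val_one]
  linear_combination (2 * (-1) ^ (N + 1)) * hq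

theorem map_thetaSum {S : Type*} [CommRing S] (φ : R →+* S) (q : Rˣ) (N : ℕ) :
    φ (thetaSum q N) = thetaSum (Units.map (φ : R →* S) q) N := by
  induction N with
  | zero => simp [thetaSum_zero]
  | succ N ih =>
    have h2 : φ 2 = 2 := map_ofNat φ 2
    simp [thetaSum_succ, ih, h2]

/-- Eliminates the inhomogeneous term between two consecutive instances of `thetaSum_succ`. -/
theorem thetaSum_rec (q : Rˣ) (N : ℕ) : thetaSum q (N + 2) =
    (q : R) ^ (2 * N + 3) * thetaSum q N -
      q * (1 - (q : R) ^ (2 * N + 3)) * thetaSum q (N + 1) := by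
  rw [thetaSum_succ q (N + 1), thetaSum_succ q N]
  ring

end ThetaSum

/-! ### Both fractions over a field -/

section Field

variable {K : Type*} [Field K]

theorem tailCoeff_one_eq_thetaSum (q : Kˣ) (hq : ∀ n : ℕ, (q : K) ^ (n + 1) ≠ 1) (N : ℕ) :
    tailCoeff (q : K) 1 N = thetaSum q N := by
  induction N using Nat.twoStepInduction with
  | zero => rw [tailCoeff_zero_right hq, thetaSum_zero]
  | one => rw [tailCoeff_one_one hq, thetaSum_succ, thetaSum_zero]; ring
  | more N h1 h2 => rw [tailCoeff_one_rec hq, thetaSum_rec, h1, h2]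

theorem coeff_convergent_one_add_X_of_field (q : Kˣ) (hq : ∀ n : ℕ, (q : K) ^ (n + 1) ≠ 1)
    {N m : ℕ} (h : N < m) :
    coeff N (convergent (1 + X) (numerators (q : K) 1) m) = thetaSum q N := by
  rw [coeff_convergent_eq (u := fun i => PowerSeries.mk (tailCoeff (q : K) i)) (by simp)
    (X_dvd_numerators _ _) _ _ h, coeff_mk, tailCoeff_one_eq_thetaSum q hq]
  · ext n
    simp [tailCoeff, coeff_one]
  · intro i
    ext n
    cases n with
    | zero => simp [numerators, add_mul, mul_assoc, tailCoeff_zero_right hq]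
    | succ n =>
      simp only [numerators, add_mul, one_mul, mul_one, map_add, map_sub, mul_assoc, coeff_mk,
        coeff_succ_X_mul, coeff_C_mul]
      exact tailCoeff_rec hq i n

theorem coeff_convergent_one_of_field (q : Kˣ) (hq : ∀ n : ℕ, (q : K) ^ (n + 1) ≠ 1)
    {N m : ℕ} (h : N < m) :
    coeff N (convergent 1 (numerators (q : K) 1) m) =
      ∑ k ∈ Finset.range (N + 1), (ballot (2 * N) (N - k) : K) * thetaSum q k := by
  have h0 : ∀ i, ballotTransform (tailCoeff (q : K)) i 0 = 1 := by
    intro i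
    cases i <;> simp [ballotTransform, tailCoeff_zero_right hq, ballot_zero]
  rw [coeff_convergent_eq (u := fun i => PowerSeries.mk (ballotTransform (tailCoeff (q : K)) i))
    (by simp) (X_dvd_numerators _ _) _ _ h, coeff_mk]
  · simp [ballotTransform, tailCoeff_one_eq_thetaSum q hq]
  · ext n
    simp [ballotTransform, tailCoeff, coeff_one]
  · intro i
    ext n
    cases n with
    | zero => simp [numerators, mul_assoc, h0]
    | succ n =>
      simp only [numerators, one_mul, mul_one, map_sub, mul_assoc, coeff_mk,
        coeff_succ_X_mul, coeff_C_mul]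
      exact ballotTransform_rec (c := fun i => (1 - (q : K) ^ (i + 1)) ^ 2)
        (fun N => by simp [tailCoeff])
        (fun m => by simp [tailCoeff_zero_right hq]) (tailCoeff_rec hq) i n

end Field

/-! ### Specialization from `ℤ[T;T⁻¹]` to arbitrary rings -/

section Transfer

open LaurentPolynomial

/-- The indeterminate of `ℤ[T;T⁻¹]` as a unit. -/
noncomputable def laurentUnit : (LaurentPolynomial ℤ)ˣ where
  val := T 1
  inv := T (-1)
  val_inv := by rw [← T_add, add_neg_cancel, T_zero]
  inv_val := by rw [← T_add, neg_add_cancel, T_zero]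

theorem algebraMap_laurentUnit_pow_ne_one (n : ℕ) :
    ((Units.map (algebraMap (LaurentPolynomial ℤ) (FractionRing (LaurentPolynomial ℤ)) :
      LaurentPolynomial ℤ →* FractionRing (LaurentPolynomial ℤ)) laurentUnit :
        (FractionRing (LaurentPolynomial ℤ))ˣ) : FractionRing (LaurentPolynomial ℤ)) ^ (n + 1) ≠ 1 := by
  intro h
  have h1 : (T 1 : LaurentPolynomial ℤ) ^ (n + 1) = T 0 := by
    rw [T_zero]
    apply IsFractionRing.injective (LaurentPolynomial ℤ) (FractionRing (LaurentPolynomial ℤ))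
    rw [map_pow, map_one]
    exact h
  rw [T_pow] at h1
  have h2 := congrArg degree h1
  rw [degree_T, degree_T] at h2
  -- Comparing degrees: `T ^ (n + 1) = 1` would force `n + 1 = 0`.
  have h3 := WithBot.coe_injective h2
  push_cast at h3
  omega

theorem map_coeff_convergent {A B : Type*} [CommRing A] [CommRing B] (φ : A →+* B) (q : A)
    (b : PowerSeries A) (hb : PowerSeries.constantCoeff b = 1) (N m : ℕ) :
    φ (PowerSeries.coeff N (convergent b (numerators q 1) m)) =
      PowerSeries.coeff N (convergent (PowerSeries.map φ b) (numerators (φ q) 1) m) := by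
  rw [← PowerSeries.coeff_map, map_convergent φ b hb m _ (X_dvd_numerators q 1)]
  simp only [map_numerators, map_one]

theorem eval₂_laurentUnit {R : Type*} [CommRing R] (q : Rˣ) :
    Units.map (eval₂ (Int.castRingHom R) q : LaurentPolynomial ℤ →* R) laurentUnit = q := by
  ext
  simp [laurentUnit]

theorem coeff_convergent_one_add_X {R : Type*} [CommRing R] (q : Rˣ) {N m : ℕ} (h : N < m) :
    PowerSeries.coeff N (convergent (1 + PowerSeries.X) (numerators (q : R) 1) m) =
      thetaSum q N := by
  have key : PowerSeries.coeff N (convergent (1 + PowerSeries.X)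
      (numerators (laurentUnit : LaurentPolynomial ℤ) 1) m) = thetaSum laurentUnit N := by
    apply IsFractionRing.injective (LaurentPolynomial ℤ) (FractionRing (LaurentPolynomial ℤ))
    rw [map_coeff_convergent _ _ _ (by simp), map_thetaSum,
      ← coeff_convergent_one_add_X_of_field _ algebraMap_laurentUnit_pow_ne_one h]
    simp
  have := congrArg (eval₂ (Int.castRingHom R) q) key
  rw [map_coeff_convergent _ _ _ (by simp), map_thetaSum, eval₂_laurentUnit] at this
  rw [← this, ← congrArg Units.val (eval₂_laurentUnit q)]
  simp

theorem coeff_convergent_one {R : Type*} [CommRing R] (q : Rˣ) {N m : ℕ} (h : N < m) :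
    PowerSeries.coeff N (convergent 1 (numerators (q : R) 1) m) =
      ∑ k ∈ Finset.range (N + 1), (ballot (2 * N) (N - k) : R) * thetaSum q k := by
  have key : PowerSeries.coeff N (convergent 1
      (numerators (laurentUnit : LaurentPolynomial ℤ) 1) m) =
      ∑ k ∈ Finset.range (N + 1),
        (ballot (2 * N) (N - k) : LaurentPolynomial ℤ) * thetaSum laurentUnit k := by
    apply IsFractionRing.injective (LaurentPolynomial ℤ) (FractionRing (LaurentPolynomial ℤ))
    rw [map_coeff_convergent _ _ _ (by simp)]
    simp only [map_sum, map_mul, map_intCast, map_thetaSum]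
    rw [← coeff_convergent_one_of_field _ algebraMap_laurentUnit_pow_ne_one h]
    simp
  have := congrArg (eval₂ (Int.castRingHom R) q) key
  rw [map_coeff_convergent _ _ _ (by simp)] at this
  simp only [map_sum, map_mul, map_intCast, map_thetaSum, eval₂_laurentUnit] at this
  rw [← this, ← congrArg Units.val (eval₂_laurentUnit q)]
  simp

end Transfer

end FormalCF

theorem mainTheorem6 {R : Type*} [CommRing R] (q : Rˣ) :
    (∃ F : PowerSeries R,
      FormalCF.HasValue (1 + PowerSeries.X) (FormalCF.numerators (q : R) 1) F ∧
      ∀ N : ℕ, PowerSeries.coeff N F =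
        (q : R) ^ (N * (N + 1)) *
          ∑ n ∈ Finset.Icc (-(N : ℤ)) (N : ℤ), (((-1 : Rˣ) ^ n * q ^ (-(n ^ 2)) : Rˣ) : R)) ∧
    (∃ G : PowerSeries R,
      FormalCF.HasValue 1 (FormalCF.numerators (q : R) 1) G ∧
      ∀ N : ℕ, PowerSeries.coeff N G =
        ∑ k ∈ Finset.range (N + 1),
          ((FormalCF.binom (2 * N) ((N : ℤ) - k) - FormalCF.binom (2 * N) ((N : ℤ) - k - 1) : ℤ) : R) *
            ((q : R) ^ (k * (k + 1)) *
              ∑ j ∈ Finset.Icc (-(k : ℤ)) (k : ℤ),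
                (((-1 : Rˣ) ^ j * q ^ (-(j ^ 2)) : Rˣ) : R))) := by
  refine ⟨⟨PowerSeries.mk (FormalCF.thetaSum q), fun N => ?_, fun N => ?_⟩,
    ⟨PowerSeries.mk fun N => ∑ k ∈ Finset.range (N + 1),
      (FormalCF.ballot (2 * N) (N - k) : R) * FormalCF.thetaSum q k, fun N => ?_, fun N => ?_⟩⟩
  · filter_upwards [Filter.eventually_gt_atTop N] with m hm
    rw [FormalCF.coeff_convergent_one_add_X q hm, PowerSeries.coeff_mk]
  · rw [PowerSeries.coeff_mk, FormalCF.thetaSum]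
  · filter_upwards [Filter.eventually_gt_atTop N] with m hm
    rw [FormalCF.coeff_convergent_one q hm, PowerSeries.coeff_mk]
  · rw [PowerSeries.coeff_mk]
    rfl
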